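/- Let $N\ge 2$ and $K>0$. There is a constant $C=C(N,K)>0$, depending only on $N$ and $K$, such that the following holds. Let $r>0$, let $B_r=\{x\in\mathbb{R}^N:|x|<r\}$, and let $E\subset\mathbb{R}^N$ be a set with Lipschitz boundary (i.e. near every point of $\partial E$ the set $E$ is, in suitable orthonormal coordinates and up to points of the graph itself, the region lying below the graph of a Lipschitz function of $N-1$ variables) such that $|E|\le K|B_r|$ and whose in-radius $r_{in}(E)=\sup\{\rho\ge 0: B_\rho(x)\subset E\text{ for some }x\in\mathbb{R}^N\}$ satisfies $r_{in}(E)\ge r/K$. Then $$\frac{|E\,\Delta\,B_r|}{|B_r|}\le C\left(\frac{1}{r^{N-1}}\int_{\partial E}\Big(\frac{|x|}{r}-1\Big)^2\,d\sigma(x)\right)^{1/2},$$ where $|\cdot|$ of a set is its Lebesgue measure, $\Delta$ is the symmetric difference, and $\sigma$ is $(N-1)$-dimensional surface (Hausdorff) measure on $\partial E$. (If the integral is infinite the inequality is trivial.) -/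

import Mathlib

open MeasureTheory Set Metric
open scoped ENNReal NNReal symmDiff

/-- A set `E ⊆ ℝᴺ` has Lipschitz boundary if near each boundary point `p`, after choosing a unit
direction `v`, it is the region below the graph of a Lipschitz function `φ` defined on the
hyperplane `v^⊥`.  Points on the graph itself may or may not belong to `E`, so that open and
closed sets are both covered. -/
def HasLipschitzBoundary {N : ℕ} (E : Set (EuclideanSpace ℝ (Fin N))) : Prop :=
  ∀ p ∈ frontier E, ∃ v : EuclideanSpace ℝ (Fin N), ‖v‖ = 1 ∧
    ∃ (L : ℝ≥0) (φ : (Submodule.span ℝ {v})ᗮ → ℝ), LipschitzWith L φ ∧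
      ∃ U : Set (EuclideanSpace ℝ (Fin N)), IsOpen U ∧ p ∈ U ∧
        ∀ x ∈ U,
          (inner ℝ v x < φ ((Submodule.span ℝ {v})ᗮ.orthogonalProjectionOnto x) → x ∈ E) ∧
          (x ∈ E → inner ℝ v x ≤ φ ((Submodule.span ℝ {v})ᗮ.orthogonalProjectionOnto x))

/-- The in-radius of `E`: the supremum of the radii of the open balls contained in `E`. -/
noncomputable def inRadius {N : ℕ} (E : Set (EuclideanSpace ℝ (Fin N))) : ℝ≥0∞ :=
  ⨆ (x : EuclideanSpace ℝ (Fin N)) (ρ : ℝ≥0) (_ : ball x (ρ : ℝ) ⊆ E), (ρ : ℝ≥0∞)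

/-- `∫_{∂E} (|x|/r - 1)² dσ(x)`, where `σ` is the `(N-1)`-dimensional Hausdorff measure, normalized
so as to agree with Lebesgue measure on `ℝᴺ⁻¹`; the value may be `∞`. -/
noncomputable def boundarySqDist {N : ℕ} (E : Set (EuclideanSpace ℝ (Fin N))) (r : ℝ) : ℝ≥0∞ :=
  ∫⁻ x in frontier E, ENNReal.ofReal ((‖x‖ / r - 1) ^ 2)
    ∂(Measure.euclideanHausdorffMeasure (N - 1) : Measure (EuclideanSpace ℝ (Fin N)))

/-! Write N = n + 1, let δ² be the normalized boundary integral, and set t = δr. The shell of width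
t on either side of the sphere has volume of order δr^N. A point of E beyond the shell is joined to
the frontier by its outward ray, and a point of the inner ball missing from E by the segment to the
centre p of a ball inside E. Such points are therefore images of frontier points y under homotheties
that displace y by at most a multiple of ||y| - r|. The set swept out has volume at most a constant
times ∫ ||y| - r| dσ (`exists_volume_homothetyTube_le`), and since ||y| - r| ≥ t at these y, the
integrand is at most (|y| - r)²/t. This again gives order δr^N (`exists_volume_diff_ball_le`,
`exists_volume_ball_diff_le`). The in-radius supplies p when δ is small; for large δ the bound on
|E| suffices. -/

lemma volume_ball_eq_ofReal {n : ℕ} (x : EuclideanSpace ℝ (Fin n)) {r : ℝ} (hr : 0 < r) :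
    volume (ball x r) =
      ENNReal.ofReal (r ^ n * volume.real (ball (0 : EuclideanSpace ℝ (Fin n)) 1)) := by
  rw [Measure.addHaar_ball_of_pos _ _ hr, ENNReal.ofReal_mul (by positivity), Measure.real,
    ENNReal.ofReal_toReal measure_ball_lt_top.ne, finrank_euclideanSpace_fin]

/-! ### Volume of homothety tubes over a set of finite surface measure -/

lemma volume_segment_nhd_le {n : ℕ} (y e : EuclideanSpace ℝ (Fin (n + 1))) (he : ‖e‖ ≤ 1)
    {H ε : ℝ} (hε : 0 < ε) (hH : ε ≤ H) :
    volume {z | ∃ τ : ℝ, |τ| ≤ H ∧ dist z (y + τ • e) ≤ ε} ≤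
      ENNReal.ofReal (4 * 2 ^ (n + 1) *
        volume.real (ball (0 : EuclideanSpace ℝ (Fin (n + 1))) 1) * H * ε ^ n) := by
  set J : Finset ℤ := Finset.Icc ⌊-(H / ε)⌋ ⌊H / ε⌋
  have hsub : {z | ∃ τ : ℝ, |τ| ≤ H ∧ dist z (y + τ • e) ≤ ε} ⊆
      ⋃ j ∈ J, ball (y + ((j : ℝ) * ε) • e) (2 * ε) := by
    rintro z ⟨τ, hτ, hz⟩
    rw [abs_le] at hτ
    have h1 : -(H / ε) ≤ τ / ε := by
      rw [← neg_div]; exact div_le_div_of_nonneg_right hτ.1 hε.le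
    have h2 : τ / ε ≤ H / ε := div_le_div_of_nonneg_right hτ.2 hε.le
    simp only [mem_iUnion]
    refine ⟨⌊τ / ε⌋, Finset.mem_Icc.2 ⟨Int.floor_mono h1, Int.floor_mono h2⟩, ?_⟩
    have h3 : (⌊τ / ε⌋ : ℝ) * ε ≤ τ := (le_div_iff₀ hε).1 (Int.floor_le _)
    have h4 : τ < ((⌊τ / ε⌋ : ℝ) + 1) * ε := (div_lt_iff₀ hε).1 (Int.lt_floor_add_one _)
    have h5 : dist (y + τ • e) (y + ((⌊τ / ε⌋ : ℝ) * ε) • e) < ε := by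
      rw [dist_add_left, dist_eq_norm, ← sub_smul, norm_smul, Real.norm_eq_abs,
        abs_of_nonneg (by linarith)]
      nlinarith [norm_nonneg e]
    calc dist z _ ≤ _ := dist_triangle _ (y + τ • e) _
      _ < 2 * ε := by linarith
  have hcard : (J.card : ℝ) ≤ 4 * H / ε := by
    have h1 : (1 : ℝ) ≤ H / ε := (one_le_div hε).2 hH
    have h0 : ⌊-(H / ε)⌋ ≤ ⌊H / ε⌋ := Int.floor_mono (by linarith)
    have h2 : ((J.card : ℤ) : ℝ) = (⌊H / ε⌋ : ℝ) + 1 - ⌊-(H / ε)⌋ := by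
      rw [Int.card_Icc, Int.toNat_of_nonneg (by linarith)]; push_cast; ring
    have h3 := Int.floor_le (H / ε)
    have h4 := Int.lt_floor_add_one (-(H / ε))
    rw [Int.cast_natCast] at h2
    rw [h2, mul_div_assoc]
    linarith
  calc _ ≤ volume (⋃ j ∈ J, ball (y + ((j : ℝ) * ε) • e) (2 * ε)) := measure_mono hsub
    _ ≤ ∑ j ∈ J, volume (ball (y + ((j : ℝ) * ε) • e) (2 * ε)) := measure_biUnion_finset_le _ _
    _ = ENNReal.ofReal (J.card *
        ((2 * ε) ^ (n + 1) * volume.real (ball (0 : EuclideanSpace ℝ (Fin (n + 1))) 1))) := by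
      simp_rw [volume_ball_eq_ofReal _ (by positivity : 0 < 2 * ε)]
      rw [Finset.sum_const, nsmul_eq_mul, ENNReal.ofReal_mul (Nat.cast_nonneg _),
        ENNReal.ofReal_natCast]
    _ ≤ _ := by
      apply ENNReal.ofReal_le_ofReal
      calc _ ≤ 4 * H / ε * ((2 * ε) ^ (n + 1) *
            volume.real (ball (0 : EuclideanSpace ℝ (Fin (n + 1))) 1)) := by gcongr
        _ = _ := by field_simp; ring

/-- The points reached from `A` by homotheties centred at `p` whose ratio is at most `L` in absolute
value and which displace the point by at most `w`. -/
def homothetyTube {n : ℕ} (p : EuclideanSpace ℝ (Fin n)) (L : ℝ)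
    (w : EuclideanSpace ℝ (Fin n) → ℝ) (A : Set (EuclideanSpace ℝ (Fin n))) :
    Set (EuclideanSpace ℝ (Fin n)) :=
  {z | ∃ y ∈ A, ∃ l : ℝ, |l - 1| * ‖y - p‖ ≤ w y ∧ |l| ≤ L ∧ z = p + l • (y - p)}

lemma homothetyTube_mono {n : ℕ} {p : EuclideanSpace ℝ (Fin n)} {L : ℝ}
    {w w' : EuclideanSpace ℝ (Fin n) → ℝ} {A B : Set (EuclideanSpace ℝ (Fin n))} (h : A ⊆ B)
    (hw : ∀ y ∈ A, w y ≤ w' y) :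
    homothetyTube p L w A ⊆ homothetyTube p L w' B := by
  rintro z ⟨y, hy, l, h1, h2⟩
  exact ⟨y, h hy, l, h1.trans (hw y hy), h2⟩

lemma homothetyTube_iUnion {n : ℕ} {ι : Sort*} (p : EuclideanSpace ℝ (Fin n)) (L : ℝ)
    (w : EuclideanSpace ℝ (Fin n) → ℝ) (A : ι → Set (EuclideanSpace ℝ (Fin n))) :
    homothetyTube p L w (⋃ i, A i) = ⋃ i, homothetyTube p L w (A i) := by
  ext z
  simp only [homothetyTube, mem_iUnion, mem_ofPred_eq]
  constructor
  · rintro ⟨y, ⟨i, hi⟩, h⟩; exact ⟨i, y, hi, h⟩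
  · rintro ⟨i, y, hi, h⟩; exact ⟨y, ⟨i, hi⟩, h⟩

/-- A homothety of ratio at most L spreads U by at most Ld, so the tube lies within Ld of a segment
of half-length 2M through y₀ in the direction from p: a thin cylinder of volume of order M(Ld)^n. -/
lemma volume_homothetyTube_le_of_diam {n : ℕ} (p : EuclideanSpace ℝ (Fin (n + 1))) {L M d : ℝ}
    (hL : 1 ≤ L) (hd : 0 < d) (hdM : (L + 1) * d ≤ M) (U : Set (EuclideanSpace ℝ (Fin (n + 1))))
    (hU : ediam U ≤ ENNReal.ofReal d) :
    volume (homothetyTube p L (fun _ => M) U) ≤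
      ENNReal.ofReal (8 * 2 ^ (n + 1) *
        volume.real (ball (0 : EuclideanSpace ℝ (Fin (n + 1))) 1) * M * L ^ n) *
        ENNReal.ofReal d ^ n := by
  rcases U.eq_empty_or_nonempty with rfl | ⟨y₀, hy₀⟩
  · simp [homothetyTube]
  -- If y₀ = p then e = 0, which is why only `‖e‖ ≤ 1` is asked of the direction.
  set e : EuclideanSpace ℝ (Fin (n + 1)) := ‖y₀ - p‖⁻¹ • (y₀ - p)
  have hsub : homothetyTube p L (fun _ => M) U ⊆
      {z | ∃ τ : ℝ, |τ| ≤ 2 * M ∧ dist z (y₀ + τ • e) ≤ L * d} := by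
    rintro z ⟨y, hy, l, h1, h2, rfl⟩
    have hyy : ‖y - y₀‖ ≤ d := by
      rw [← dist_eq_norm]
      have := (edist_le_ediam_of_mem hy hy₀).trans hU
      rw [edist_dist] at this
      exact (ENNReal.ofReal_le_ofReal_iff hd.le).1 this
    have htri : ‖y₀ - p‖ ≤ ‖y - p‖ + d := by
      have : y₀ - p = (y - p) - (y - y₀) := by abel
      rw [this]; exact (norm_sub_le _ _).trans (by linarith)
    have hl : |l - 1| ≤ L + 1 := (abs_sub _ _).trans (by simpa using h2)
    refine ⟨(l - 1) * ‖y₀ - p‖, ?_, ?_⟩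
    · rw [abs_mul, abs_norm]
      calc _ ≤ |l - 1| * (‖y - p‖ + d) := by gcongr
        _ = |l - 1| * ‖y - p‖ + |l - 1| * d := by ring
        _ ≤ M + (L + 1) * d := by gcongr
        _ ≤ _ := by linarith
    · have he : ((l - 1) * ‖y₀ - p‖) • e = (l - 1) • (y₀ - p) := by
        rcases eq_or_ne (y₀ - p) 0 with h0 | h0
        · simp [e, h0]
        · rw [mul_smul, smul_inv_smul₀ (norm_ne_zero_iff.2 h0)]
      rw [he, dist_eq_norm]
      have : p + l • (y - p) - (y₀ + (l - 1) • (y₀ - p)) = l • (y - y₀) := by module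
      rw [this, norm_smul, Real.norm_eq_abs]
      gcongr
  have he : ‖e‖ ≤ 1 := by
    rw [norm_smul, norm_inv, norm_norm]; exact inv_mul_le_one
  have hLd : L * d ≤ 2 * M := by nlinarith
  refine (measure_mono hsub).trans ((volume_segment_nhd_le y₀ e he (by positivity) hLd).trans ?_)
  have hM : 0 < M := lt_of_lt_of_le (by positivity) hdM
  rw [← ENNReal.ofReal_pow hd.le, ← ENNReal.ofReal_mul (by positivity)]
  apply ENNReal.ofReal_le_ofReal
  rw [mul_pow]
  apply le_of_eq; ring

/-- Each piece of a fine cover contributes a multiple of diam^n; summing and taking the infimum over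
covers yields the Hausdorff measure. -/
lemma volume_homothetyTube_const_le_hausdorffMeasure {n : ℕ}
    (p : EuclideanSpace ℝ (Fin (n + 1)))
    {L M : ℝ} (hL : 1 ≤ L) (hM : 0 < M) (A : Set (EuclideanSpace ℝ (Fin (n + 1)))) :
    volume (homothetyTube p L (fun _ => M) A) ≤
      ENNReal.ofReal (8 * 2 ^ (n + 1) *
        volume.real (ball (0 : EuclideanSpace ℝ (Fin (n + 1))) 1) * M * L ^ n) *
        Measure.hausdorffMeasure (n : ℝ) A := by
  set c : ℝ := 8 * 2 ^ (n + 1) *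
        volume.real (ball (0 : EuclideanSpace ℝ (Fin (n + 1))) 1) * M * L ^ n
  have hω : 0 < volume.real (ball (0 : EuclideanSpace ℝ (Fin (n + 1))) 1) :=
    ENNReal.toReal_pos (measure_ball_pos _ _ one_pos).ne' measure_ball_lt_top.ne
  have hc : 0 < c := by positivity
  have hc0 : ENNReal.ofReal c ≠ 0 := by simpa using hc
  -- The factor 2 leaves room for d slightly above the diameter of a piece: the cylinder bound needs
  -- d > 0, but the diameter may be 0, so d tends to it from above.
  set ε : ℝ := M / (L + 1) / 2
  have hε : 0 < ε := by positivity
  have hε2 : (L + 1) * (2 * ε) = M := by simp only [ε]; field_simp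
  have key : ∀ U : Set (EuclideanSpace ℝ (Fin (n + 1))), ediam U ≤ ENNReal.ofReal ε →
      volume (homothetyTube p L (fun _ => M) U) ≤ ENNReal.ofReal c * ediam U ^ (n : ℝ) := by
    intro U hU
    have hfin : ediam U ≠ ∞ := ne_top_of_le_ne_top ENNReal.ofReal_ne_top hU
    set d₀ := (ediam U).toReal
    have hd₀ : ediam U = ENNReal.ofReal d₀ := (ENNReal.ofReal_toReal hfin).symm
    have hd0 : 0 ≤ d₀ := ENNReal.toReal_nonneg
    have hd₀ε : d₀ ≤ ε := by
      rw [hd₀] at hU; exact (ENNReal.ofReal_le_ofReal_iff hε.le).1 hU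
    have hcont : Filter.Tendsto (fun d : ℝ => ENNReal.ofReal c * ENNReal.ofReal d ^ n)
        (nhdsWithin d₀ (Ioi d₀)) (nhds (ENNReal.ofReal c * ENNReal.ofReal d₀ ^ n)) := by
      refine ENNReal.Tendsto.const_mul (Filter.Tendsto.mono_left ?_ nhdsWithin_le_nhds)
        (Or.inr ENNReal.ofReal_ne_top)
      exact (ENNReal.continuous_pow n).continuousAt.tendsto.comp
        ENNReal.continuous_ofReal.continuousAt
    rw [ENNReal.rpow_natCast, hd₀]
    refine ge_of_tendsto hcont ?_
    filter_upwards [Ioo_mem_nhdsGT (show d₀ < 2 * ε by linarith)] with d hd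
    refine volume_homothetyTube_le_of_diam p hL (hd0.trans_lt hd.1) ?_ U ?_
    · rw [← hε2]; gcongr; exact hd.2.le
    · rw [hd₀]; exact ENNReal.ofReal_le_ofReal hd.1.le
  rw [Measure.hausdorffMeasure_apply]
  refine le_trans ?_ (mul_le_mul_right
    (le_iSup₂_of_le (ENNReal.ofReal ε) (by simpa using hε) le_rfl) _)
  simp only [ENNReal.mul_iInf_of_ne hc0 ENNReal.ofReal_ne_top, ← ENNReal.tsum_mul_left]
  refine le_iInf fun t => le_iInf fun ht => le_iInf fun htd => ?_
  calc _ ≤ volume (⋃ i, homothetyTube p L (fun _ => M) (t i)) := by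
        rw [← homothetyTube_iUnion]
        exact measure_mono (homothetyTube_mono ht fun _ _ => le_rfl)
    _ ≤ ∑' i, volume (homothetyTube p L (fun _ => M) (t i)) := measure_iUnion_le _
    _ ≤ _ := by
      refine ENNReal.tsum_le_tsum fun i => ?_
      rcases (t i).eq_empty_or_nonempty with h | h
      · simp [h, homothetyTube]
      · simpa [h] using key (t i) (htd i)

lemma exists_volume_homothetyTube_const_le (n : ℕ) :
    ∃ C : ℝ, 0 < C ∧ ∀ (p : EuclideanSpace ℝ (Fin (n + 1))) (L M : ℝ), 1 ≤ L → 0 < M →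
      ∀ A : Set (EuclideanSpace ℝ (Fin (n + 1))),
        volume (homothetyTube p L (fun _ => M) A) ≤
          ENNReal.ofReal (C * M * L ^ n) * Measure.euclideanHausdorffMeasure n A := by
  set a : ℝ≥0 := Measure.addHaarScalarFactor (volume : Measure (EuclideanSpace ℝ (Fin n)))
    (Measure.hausdorffMeasure (n : ℝ))
  have ha : 0 < a := Measure.addHaarScalarFactor_pos_of_isAddHaarMeasure _ _
  set b : ℝ := 8 * 2 ^ (n + 1) * volume.real (ball (0 : EuclideanSpace ℝ (Fin (n + 1))) 1)
  have hω : 0 < volume.real (ball (0 : EuclideanSpace ℝ (Fin (n + 1))) 1) :=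
    ENNReal.toReal_pos (measure_ball_pos _ _ one_pos).ne' measure_ball_lt_top.ne
  have hb : 0 < b := by positivity
  have ha' : (0 : ℝ) < a := ha
  refine ⟨b / a, by positivity, fun p L M hL hM A => ?_⟩
  refine (volume_homothetyTube_const_le_hausdorffMeasure p hL hM A).trans (le_of_eq ?_)
  rw [Measure.euclideanHausdorffMeasure_def, Measure.smul_apply, ENNReal.smul_def, smul_eq_mul,
    ← mul_assoc, ← ENNReal.ofReal_coe_nnreal, ← ENNReal.ofReal_mul (by positivity)]
  congr 2
  change b * M * L ^ n = b / a * M * L ^ n * a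
  field_simp

/-- On a dyadic level set of w the constant-width bound loses only a factor 2, and countably many
such sets exhaust A. -/
lemma exists_volume_homothetyTube_le (n : ℕ) :
    ∃ C : ℝ, 0 < C ∧ ∀ (p : EuclideanSpace ℝ (Fin (n + 1))) (L : ℝ), 1 ≤ L →
      ∀ (w : EuclideanSpace ℝ (Fin (n + 1)) → ℝ) (A : Set (EuclideanSpace ℝ (Fin (n + 1)))),
        Measurable w → MeasurableSet A → (∀ y ∈ A, 0 < w y) →
        volume (homothetyTube p L w A) ≤
          ENNReal.ofReal (C * L ^ n) *
            ∫⁻ y in A, ENNReal.ofReal (w y) ∂Measure.euclideanHausdorffMeasure n := by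
  obtain ⟨C, hC, h⟩ := exists_volume_homothetyTube_const_le n
  refine ⟨C * 2, by positivity, fun p L hL w A hw hA hpos => ?_⟩
  set S : ℤ → Set (EuclideanSpace ℝ (Fin (n + 1))) :=
    fun k => A ∩ w ⁻¹' Ico ((2 : ℝ) ^ k) (2 ^ (k + 1))
  have hS : ∀ k, MeasurableSet (S k) := fun k => hA.inter (hw measurableSet_Ico)
  have hAS : A = ⋃ k, S k := by
    rw [← inter_iUnion]
    refine (inter_eq_left.2 fun y hy => ?_).symm
    obtain ⟨k, hk⟩ := exists_mem_Ico_zpow (hpos y hy) (one_lt_two : (1 : ℝ) < 2)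
    exact mem_iUnion.2 ⟨k, hk⟩
  have hdisj : Pairwise (Function.onFun Disjoint S) := by
    intro i j hij
    refine Disjoint.mono inter_subset_right inter_subset_right (Disjoint.preimage _ ?_)
    refine Set.disjoint_left.2 fun x hi hj => hij ?_
    have h1 := (zpow_lt_zpow_iff_right₀ (one_lt_two : (1 : ℝ) < 2)).1 (hi.1.trans_lt hj.2)
    have h2 := (zpow_lt_zpow_iff_right₀ (one_lt_two : (1 : ℝ) < 2)).1 (hj.1.trans_lt hi.2)
    omega
  have hk : ∀ k, volume (homothetyTube p L w (S k)) ≤ ENNReal.ofReal (C * 2 * L ^ n) *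
      ∫⁻ y in S k, ENNReal.ofReal (w y) ∂Measure.euclideanHausdorffMeasure n := by
    intro k
    have h1 : volume (homothetyTube p L w (S k)) ≤
        volume (homothetyTube p L (fun _ => (2 : ℝ) ^ (k + 1)) (S k)) :=
      measure_mono (homothetyTube_mono subset_rfl fun y hy => hy.2.2.le)
    have h2 := h p L ((2 : ℝ) ^ (k + 1)) hL (by positivity) (S k)
    have h3 : ENNReal.ofReal ((2 : ℝ) ^ k) * Measure.euclideanHausdorffMeasure n (S k) ≤
        ∫⁻ y in S k, ENNReal.ofReal (w y) ∂Measure.euclideanHausdorffMeasure n := by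
      rw [← setLIntegral_const]
      exact setLIntegral_mono' (hS k) fun y hy => ENNReal.ofReal_le_ofReal hy.2.1
    refine (h1.trans h2).trans (le_trans (le_of_eq ?_) (mul_le_mul_right h3 _))
    rw [← mul_assoc, ← ENNReal.ofReal_mul (by positivity), zpow_add_one₀ two_ne_zero]
    congr 2; ring
  calc volume (homothetyTube p L w A) = volume (⋃ k, homothetyTube p L w (S k)) := by
        rw [← homothetyTube_iUnion, ← hAS]
    _ ≤ ∑' k, volume (homothetyTube p L w (S k)) := measure_iUnion_le _
    _ ≤ ∑' k, ENNReal.ofReal (C * 2 * L ^ n) *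
          ∫⁻ y in S k, ENNReal.ofReal (w y) ∂Measure.euclideanHausdorffMeasure n :=
        ENNReal.tsum_le_tsum hk
    _ = _ := by rw [ENNReal.tsum_mul_left, ← lintegral_iUnion hS hdisj, ← hAS]

/-! ### Trapping the symmetric difference in tubes over the frontier -/

lemma exists_mem_segment_mem_frontier {n : ℕ} {E : Set (EuclideanSpace ℝ (Fin n))}
    {x z : EuclideanSpace ℝ (Fin n)} (hx : x ∈ E) (hz : z ∉ E) :
    ∃ s ∈ Icc (0 : ℝ) 1, x + s • (z - x) ∈ frontier E := by
  by_contra! h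
  set f : ℝ → EuclideanSpace ℝ (Fin n) := fun s => x + s • (z - x)
  have hf : Continuous f := by fun_prop
  have hpre : IsPreconnected (f '' Icc 0 1) := isPreconnected_Icc.image f hf.continuousOn
  have hd : f '' Icc 0 1 ⊆ interior E ∪ (closure E)ᶜ := by
    rintro _ ⟨s, hs, rfl⟩
    by_contra hc
    simp only [mem_union, mem_compl_iff, not_or, not_not] at hc
    exact h s hs ⟨hc.2, hc.1⟩
  have hx' : x ∈ f '' Icc 0 1 := ⟨0, by simp, by simp [f]⟩
  have hz' : z ∈ f '' Icc 0 1 := ⟨1, by simp, by simp [f]⟩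
  obtain ⟨y, -, hy1, hy2⟩ := hpre _ _ isOpen_interior isClosed_closure.isOpen_compl hd
    ⟨x, hx', (hd hx').resolve_right fun h => h (subset_closure hx)⟩
    ⟨z, hz', (hd hz').resolve_left fun h => hz (interior_subset h)⟩
  exact hy2 (interior_subset_closure hy1)

-- The set G of such x satisfies 2G ⊆ G, so 2^(n+1)|G| ≤ |G| < ∞.
open scoped Pointwise in
lemma volume_setOf_ray_subset_eq_zero {n : ℕ} {E : Set (EuclideanSpace ℝ (Fin (n + 1)))}
    (hE : volume E ≠ ∞) : volume {x | ∀ l : ℝ, 1 ≤ l → l • x ∈ E} = 0 := by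
  set G := {x | ∀ l : ℝ, 1 ≤ l → l • x ∈ E}
  have hGE : G ⊆ E := fun x hx => by simpa using hx 1 le_rfl
  have hfin : volume G ≠ ∞ := ne_top_of_le_ne_top hE (measure_mono hGE)
  have h2 : (2 : ℝ) • G ⊆ G := by
    rintro _ ⟨x, hx, rfl⟩ l hl
    simpa [smul_smul] using hx (l * 2) (by linarith)
  have h3 := measure_mono (μ := volume) h2
  rw [Measure.addHaar_smul, finrank_euclideanSpace_fin, abs_of_pos (by positivity),
    ← ENNReal.ofReal_toReal hfin, ← ENNReal.ofReal_mul (by positivity),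
    ENNReal.ofReal_le_ofReal_iff ENNReal.toReal_nonneg] at h3
  have h4 : (2 : ℝ) ≤ 2 ^ (n + 1) := by
    simpa using pow_le_pow_right₀ (one_le_two : (1 : ℝ) ≤ 2) (Nat.le_add_left 1 n)
  have h5 : (0 : ℝ) ≤ (volume G).toReal := ENNReal.toReal_nonneg
  have h6 : (volume G).toReal = 0 := by nlinarith
  exact ((ENNReal.toReal_eq_zero_iff _).1 h6).resolve_right hfin

/-- The unnormalized boundary integral `∫_{∂E} (|x| - r)² dσ(x)`. -/
noncomputable def frontierSqIntegral {n : ℕ} (E : Set (EuclideanSpace ℝ (Fin (n + 1)))) (r : ℝ) :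
    ℝ≥0∞ :=
  ∫⁻ x in frontier E, ENNReal.ofReal ((‖x‖ - r) ^ 2) ∂Measure.euclideanHausdorffMeasure n

lemma setLIntegral_le_frontierSqIntegral {n : ℕ} {E A : Set (EuclideanSpace ℝ (Fin (n + 1)))}
    {r c : ℝ} {w : EuclideanSpace ℝ (Fin (n + 1)) → ℝ} (hA : MeasurableSet A)
    (hAE : A ⊆ frontier E) (hc : 0 ≤ c) (hw : ∀ y ∈ A, w y ≤ c * (‖y‖ - r) ^ 2) :
    ∫⁻ y in A, ENNReal.ofReal (w y) ∂Measure.euclideanHausdorffMeasure n ≤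
      ENNReal.ofReal c * frontierSqIntegral E r := by
  rw [frontierSqIntegral, ← lintegral_const_mul' _ _ ENNReal.ofReal_ne_top]
  refine le_trans (setLIntegral_mono' hA fun y hy => ?_) (lintegral_mono_set hAE)
  rw [← ENNReal.ofReal_mul hc]
  exact ENNReal.ofReal_le_ofReal (hw y hy)

/-- Almost every x in E has an outward ray that leaves E, hence meets the frontier at some mx with m
≥ 1. Contracting by 1/m about 0 moves that point by |mx| - |x| ≤ |mx| - r. -/
lemma exists_volume_diff_ball_le (n : ℕ) :
    ∃ C : ℝ, 0 < C ∧ ∀ (r t : ℝ), 0 < r → 0 < t →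
      ∀ E : Set (EuclideanSpace ℝ (Fin (n + 1))), volume E ≠ ∞ →
        volume (E \ ball 0 (r + t)) ≤ ENNReal.ofReal (C / t) * frontierSqIntegral E r := by
  obtain ⟨C, hC, h⟩ := exists_volume_homothetyTube_le n
  refine ⟨C, hC, fun r t hr ht E hE => ?_⟩
  set A := frontier E \ ball 0 (r + t)
  have hA : MeasurableSet A := isClosed_frontier.measurableSet.diff measurableSet_ball
  have hAn : ∀ y ∈ A, r + t ≤ ‖y‖ := fun y hy => by simpa using hy.2
  have hsub : E \ ball 0 (r + t) ⊆
      {x | ∀ l : ℝ, 1 ≤ l → l • x ∈ E} ∪ homothetyTube 0 1 (fun y => ‖y‖ - r) A := by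
    rintro x ⟨hxE, hx⟩
    have hxn : r + t ≤ ‖x‖ := by simpa using hx
    by_cases hray : ∀ l : ℝ, 1 ≤ l → l • x ∈ E
    · exact Or.inl hray
    right
    push Not at hray
    obtain ⟨l, hl, hlE⟩ := hray
    obtain ⟨s, hs, hsF⟩ := exists_mem_segment_mem_frontier hxE hlE
    set m : ℝ := 1 + s * (l - 1)
    have hm : 1 ≤ m := by
      have := mul_nonneg hs.1 (sub_nonneg.2 hl)
      simp only [m]; linarith
    have hm0 : 0 < m := by linarith
    have hy : x + s • (l • x - x) = m • x := by simp only [m]; module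
    rw [hy] at hsF
    have hnorm : ‖m • x‖ = m * ‖x‖ := by rw [norm_smul, Real.norm_eq_abs, abs_of_pos hm0]
    have hxm : ‖x‖ ≤ m * ‖x‖ := le_mul_of_one_le_left (norm_nonneg _) hm
    have hinv : m⁻¹ ≤ 1 := inv_le_one_of_one_le₀ hm
    refine ⟨m • x, ⟨hsF, ?_⟩, m⁻¹, ?_, ?_, ?_⟩
    · simp only [mem_ball_zero_iff, not_lt, hnorm]; linarith
    · rw [sub_zero, hnorm, abs_sub_comm, abs_of_nonneg (by linarith)]
      have : (1 - m⁻¹) * (m * ‖x‖) = m * ‖x‖ - ‖x‖ := by field_simp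
      rw [this]; linarith
    · rw [abs_of_pos (by positivity)]; exact hinv
    · simp [smul_smul, inv_mul_cancel₀ hm0.ne']
  have htube := h 0 1 le_rfl (fun y => ‖y‖ - r) A (by fun_prop) hA
    (fun y hy => by have := hAn y hy; linarith)
  have hint := setLIntegral_le_frontierSqIntegral (r := r) (c := 1 / t)
    (w := fun y => ‖y‖ - r) hA sdiff_subset (by positivity) (fun y hy => by
      have := hAn y hy
      rw [one_div, inv_mul_eq_div, le_div_iff₀ ht]; nlinarith)
  calc _ ≤ volume {x | ∀ l : ℝ, 1 ≤ l → l • x ∈ E} +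
        volume (homothetyTube 0 1 (fun y => ‖y‖ - r) A) :=
        (measure_mono hsub).trans (measure_union_le _ _)
    _ ≤ ENNReal.ofReal (C * 1 ^ n) * (ENNReal.ofReal (1 / t) * frontierSqIntegral E r) := by
      rw [volume_setOf_ray_subset_eq_zero hE, zero_add]
      exact htube.trans (mul_le_mul_right hint _)
    _ = _ := by
      rw [← mul_assoc, ← ENNReal.ofReal_mul (by positivity)]
      congr 2; field_simp; simp

/-- The segment from p to x meets the frontier at y = p + s(x - p), outside the ball of radius ρ
about p. Hence s is at least ρ/2r, and the homothety of ratio 1/s about p carries y to x. -/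
lemma exists_volume_ball_diff_le (n : ℕ) :
    ∃ C : ℝ, 0 < C ∧ ∀ (r t ρ : ℝ), 0 < r → 0 < t → t ≤ ρ → ρ ≤ r →
      ∀ (E : Set (EuclideanSpace ℝ (Fin (n + 1)))) (p : EuclideanSpace ℝ (Fin (n + 1))),
        ball p ρ ⊆ E → ‖p‖ < r - ρ →
        volume (ball 0 (r - t) \ E) ≤
          ENNReal.ofReal (C * (2 * r / ρ) ^ (n + 1) / t) * frontierSqIntegral E r := by
  obtain ⟨C, hC, h⟩ := exists_volume_homothetyTube_le n
  refine ⟨C, hC, fun r t ρ hr ht htρ hρr E p hpE hp => ?_⟩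
  have hρ : 0 < ρ := ht.trans_le htρ
  set A := frontier E ∩ ball 0 (r - t)
  have hA : MeasurableSet A := isClosed_frontier.measurableSet.inter measurableSet_ball
  have hAn : ∀ y ∈ A, ‖y‖ < r - t := fun y hy => by simpa using hy.2
  set L : ℝ := 2 * r / ρ
  have hL : 1 ≤ L := by rw [one_le_div hρ]; linarith
  have hsub : ball 0 (r - t) \ E ⊆ homothetyTube p L (fun y => L * (r - ‖y‖)) A := by
    rintro x ⟨hx, hxE⟩
    have hxn : ‖x‖ < r - t := by simpa using hx
    obtain ⟨s, hs, hsF⟩ := exists_mem_segment_mem_frontier (hpE (mem_ball_self hρ)) hxE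
    set y := p + s • (x - p)
    have hyp : y - p = s • (x - p) := by simp [y]
    have hnyp : ‖y - p‖ = s * ‖x - p‖ := by
      rw [hyp, norm_smul, Real.norm_eq_abs, abs_of_nonneg hs.1]
    have hyρ : ρ ≤ s * ‖x - p‖ := by
      rw [← hnyp, ← dist_eq_norm]
      by_contra! hlt
      exact hsF.2 (mem_interior.2 ⟨ball p ρ, hpE, isOpen_ball, hlt⟩)
    have hs0 : 0 < s := by
      rcases hs.1.eq_or_lt with h0 | h0
      · rw [← h0, zero_mul] at hyρ; linarith
      · exact h0
    have hxp : ‖x - p‖ ≤ 2 * r := (norm_sub_le _ _).trans (by linarith)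
    have hyn : ‖y‖ ≤ (1 - s) * ‖p‖ + s * ‖x‖ := by
      have : y = (1 - s) • p + s • x := by simp only [y]; module
      rw [this]
      refine (norm_add_le _ _).trans (le_of_eq ?_)
      rw [norm_smul, norm_smul, Real.norm_eq_abs, Real.norm_eq_abs, abs_of_pos hs0,
        abs_of_nonneg (sub_nonneg.2 hs.2)]
    have h1s : 0 ≤ 1 - s := sub_nonneg.2 hs.2
    have hinv : 1 ≤ s⁻¹ := (one_le_inv₀ hs0).2 hs.2
    refine ⟨y, ⟨hsF, ?_⟩, s⁻¹, ?_, ?_, ?_⟩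
    · rw [mem_ball_zero_iff]
      have h1 : (1 - s) * ‖p‖ ≤ (1 - s) * (r - t) := by gcongr; linarith
      have h2 : s * ‖x‖ < s * (r - t) := by gcongr
      linarith
    · rw [hnyp, abs_of_nonneg (by linarith)]
      have h1 : (s⁻¹ - 1) * (s * ‖x - p‖) = (1 - s) * ‖x - p‖ := by field_simp
      -- As |p| < r - ρ, the weight 1 - s on p pushes y inside the sphere by at least (1 - s)ρ; this
      -- controls the displacement (1 - s)|x - p|.
      have h2 : (1 - s) * ρ ≤ r - ‖y‖ := by
        have h1 : (1 - s) * ‖p‖ ≤ (1 - s) * (r - ρ) := by gcongr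
        have h2 : s * ‖x‖ ≤ s * r := by gcongr; linarith
        linarith
      calc _ = (1 - s) * ‖x - p‖ := h1
        _ ≤ (1 - s) * (2 * r) := by gcongr
        _ = L * ((1 - s) * ρ) := by simp only [L]; field_simp
        _ ≤ _ := mul_le_mul_of_nonneg_left h2 (by linarith)
    · rw [abs_of_pos (by positivity), le_div_iff₀ hρ]
      calc _ ≤ s⁻¹ * (s * ‖x - p‖) := by gcongr
        _ = ‖x - p‖ := by field_simp
        _ ≤ _ := hxp
    · rw [hyp, smul_smul, inv_mul_cancel₀ hs0.ne', one_smul, add_sub_cancel]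
  have hL0 : 0 < L := by linarith
  have htube := h p L hL (fun y => L * (r - ‖y‖)) A (by fun_prop) hA
    (fun y hy => by have := hAn y hy; exact mul_pos hL0 (by linarith))
  have hint := setLIntegral_le_frontierSqIntegral (r := r) (c := L / t)
    (w := fun y => L * (r - ‖y‖)) hA inter_subset_left (by positivity) (fun y hy => by
      have := hAn y hy
      have h1 : t * (r - ‖y‖) ≤ (‖y‖ - r) ^ 2 := by nlinarith
      calc L * (r - ‖y‖) = L / t * (t * (r - ‖y‖)) := by
            field_simp
        _ ≤ _ := by gcongr)
  calc _ ≤ ENNReal.ofReal (C * L ^ n) * (ENNReal.ofReal (L / t) * frontierSqIntegral E r) :=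
        (measure_mono hsub).trans (htube.trans (mul_le_mul_right hint _))
    _ = _ := by
      rw [← mul_assoc, ← ENNReal.ofReal_mul (by positivity)]
      congr 2; ring

/-! ### Shell volume, position of the inscribed ball, and assembly -/

lemma volume_ball_diff_ball_le {n : ℕ} {a b : ℝ} (ha : 0 < a) (hab : a ≤ b) :
    volume (ball (0 : EuclideanSpace ℝ (Fin (n + 1))) b \ ball 0 a) ≤
      ENNReal.ofReal (volume.real (ball (0 : EuclideanSpace ℝ (Fin (n + 1))) 1) *
        ((n + 1) * b ^ n * (b - a))) := by
  have hb : 0 < b := ha.trans_le hab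
  have key : b ^ (n + 1) - a ^ (n + 1) ≤ (n + 1) * b ^ n * (b - a) := by
    have h := one_add_mul_le_pow (a := a / b - 1) (by have := div_pos ha hb; linarith) (n + 1)
    rw [add_sub_cancel, div_pow, le_div_iff₀ (by positivity)] at h
    push_cast at h
    have : (1 + ((n : ℝ) + 1) * (a / b - 1)) * b ^ (n + 1) =
      b ^ (n + 1) - (n + 1) * b ^ n * (b - a) := by field_simp; ring
    linarith
  have hω : 0 ≤ volume.real (ball (0 : EuclideanSpace ℝ (Fin (n + 1))) 1) := measureReal_nonneg
  rw [measure_sdiff (ball_subset_ball hab) measurableSet_ball.nullMeasurableSet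
    measure_ball_lt_top.ne, volume_ball_eq_ofReal _ ha, volume_ball_eq_ofReal _ hb,
    ← ENNReal.ofReal_sub _ (by positivity)]
  apply ENNReal.ofReal_le_ofReal
  rw [← sub_mul, mul_comm]
  gcongr

lemma exists_ball_subset_of_lt_inRadius {N : ℕ} {E : Set (EuclideanSpace ℝ (Fin N))} {ρ : ℝ}
    (h : ENNReal.ofReal ρ < inRadius E) : ∃ x, ball x ρ ⊆ E := by
  simp only [inRadius, lt_iSup_iff] at h
  obtain ⟨x, s, hs, hlt⟩ := h
  refine ⟨x, (ball_subset_ball ?_).trans hs⟩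
  rw [← ENNReal.ofReal_coe_nnreal] at hlt
  exact (ENNReal.ofReal_lt_ofReal_iff'.1 hlt).1.le

/-- If |x| ≥ r, pushing the centre outward by ρ/2 gives a ball of radius ρ/4 that lies in E and
avoids the ball of radius r + t, too much volume for E to have there. -/
lemma norm_lt_of_ball_subset {n : ℕ} {E : Set (EuclideanSpace ℝ (Fin (n + 1)))}
    {x : EuclideanSpace ℝ (Fin (n + 1))} {r t ρ : ℝ} (hr : 0 < r) (ht : t ≤ ρ / 4) (hρ : 0 < ρ)
    (hx : ball x ρ ⊆ E) (hE : volume (E \ ball 0 (r + t)) <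
      ENNReal.ofReal ((ρ / 4) ^ (n + 1) *
        volume.real (ball (0 : EuclideanSpace ℝ (Fin (n + 1))) 1))) :
    ‖x‖ < r := by
  by_contra! hrx
  have hx0 : 0 < ‖x‖ := hr.trans_le hrx
  refine hE.not_ge ?_
  rw [← volume_ball_eq_ofReal ((1 + ρ / 2 / ‖x‖) • x) (by positivity : 0 < ρ / 4)]
  refine measure_mono fun z hz => ?_
  rw [mem_ball] at hz
  have h1 : dist ((1 + ρ / 2 / ‖x‖) • x) x = ρ / 2 := by
    rw [dist_eq_norm, show (1 + ρ / 2 / ‖x‖) • x - x = (ρ / 2 / ‖x‖) • x by module, norm_smul,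
      Real.norm_eq_abs, abs_of_pos (by positivity)]
    field_simp
  have h2 : ‖(1 + ρ / 2 / ‖x‖) • x‖ = ‖x‖ + ρ / 2 := by
    rw [norm_smul, Real.norm_eq_abs, abs_of_pos (by positivity)]
    field_simp
  refine ⟨hx ?_, ?_⟩
  · rw [mem_ball]
    have := dist_triangle z ((1 + ρ / 2 / ‖x‖) • x) x
    linarith
  · rw [mem_ball_zero_iff, not_lt]
    rw [dist_comm, dist_eq_norm] at hz
    have := norm_sub_norm_le ((1 + ρ / 2 / ‖x‖) • x) z
    linarith

lemma exists_volume_symmDiff_ball_le_of_lt (n : ℕ) {K : ℝ} (hK : 1 ≤ K) :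
    ∃ C : ℝ, 0 < C ∧ ∃ ε : ℝ, 0 < ε ∧ ∀ (r δ : ℝ), 0 < r → 0 < δ → δ < ε →
      ∀ E : Set (EuclideanSpace ℝ (Fin (n + 1))), volume E ≠ ∞ →
        ENNReal.ofReal (r / K) ≤ inRadius E →
        frontierSqIntegral E r ≤ ENNReal.ofReal (δ ^ 2 * r ^ (n + 2)) →
        volume (E ∆ ball 0 r) ≤ ENNReal.ofReal (C * δ * r ^ (n + 1)) := by
  obtain ⟨C₁, hC₁, hext⟩ := exists_volume_diff_ball_le n
  obtain ⟨C₂, hC₂, hint⟩ := exists_volume_ball_diff_le n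
  set ω := volume.real (ball (0 : EuclideanSpace ℝ (Fin (n + 1))) 1)
  have hω : 0 < ω := ENNReal.toReal_pos (measure_ball_pos _ _ one_pos).ne' measure_ball_lt_top.ne
  have hK0 : 0 < K := by linarith
  -- The first threshold gives δr ≤ ρ = r/(8K); the second makes the volume of E beyond the shell
  -- smaller than that of a ball of radius ρ.
  refine ⟨C₁ + ω * ((n + 1) * 2 ^ n) + (C₂ * (16 * K) ^ (n + 1) + ω * ((n + 1) * 2 ^ n)),
    by positivity, min (1 / (8 * K)) ((1 / (8 * K)) ^ (n + 1) * ω / C₁), by positivity, ?_⟩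
  intro r δ hr hδ hδε E hE hin hI
  obtain ⟨hδ1, hδ2⟩ := lt_min_iff.1 hδε
  have h8K : 1 / (8 * K) ≤ 1 / 8 := one_div_le_one_div_of_le (by norm_num) (by linarith)
  set ρ : ℝ := r / (8 * K)
  have hρ : 0 < ρ := by positivity
  have htρ : δ * r ≤ ρ := by
    have : ρ = 1 / (8 * K) * r := by simp only [ρ]; ring
    rw [this]; gcongr
  have hρr : ρ ≤ r / 8 := div_le_div_of_nonneg_left hr.le (by norm_num) (by linarith)
  have hI' : ∀ c : ℝ, 0 ≤ c → ENNReal.ofReal (c / (δ * r)) * frontierSqIntegral E r ≤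
      ENNReal.ofReal (c * δ * r ^ (n + 1)) := by
    intro c hc
    refine (mul_le_mul_right hI _).trans (le_of_eq ?_)
    rw [← ENNReal.ofReal_mul (by positivity)]
    congr 1; field_simp; ring
  have hshell : ∀ a b : ℝ, 0 < a → b - a = δ * r → b ≤ 2 * r →
      volume (ball (0 : EuclideanSpace ℝ (Fin (n + 1))) b \ ball 0 a) ≤
        ENNReal.ofReal (ω * ((n + 1) * 2 ^ n) * δ * r ^ (n + 1)) := by
    intro a b ha hab hb
    have hδr : 0 < δ * r := by positivity
    refine (volume_ball_diff_ball_le ha (by linarith)).trans (ENNReal.ofReal_le_ofReal ?_)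
    rw [hab]
    have hb0 : 0 ≤ b := by linarith
    calc ω * ((n + 1) * b ^ n * (δ * r)) ≤ ω * ((n + 1) * (2 * r) ^ n * (δ * r)) := by gcongr
      _ = _ := by rw [mul_pow]; ring
  have hE1 : volume (E \ ball 0 (r + δ * r)) ≤ ENNReal.ofReal (C₁ * δ * r ^ (n + 1)) :=
    (hext r (δ * r) hr (by positivity) E hE).trans (hI' C₁ hC₁.le)
  obtain ⟨x, hx⟩ : ∃ x, ball x (4 * ρ) ⊆ E := by
    refine exists_ball_subset_of_lt_inRadius (lt_of_lt_of_le ?_ hin)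
    rw [ENNReal.ofReal_lt_ofReal_iff (by positivity)]
    have : r / K = 8 * ρ := by simp only [ρ]; field_simp
    linarith
  have hxr : ‖x‖ < r := by
    refine norm_lt_of_ball_subset hr (t := δ * r) (ρ := 4 * ρ) (by linarith) (by positivity) hx
      (hE1.trans_lt ?_)
    rw [ENNReal.ofReal_lt_ofReal_iff (by positivity)]
    rw [lt_div_iff₀ hC₁] at hδ2
    calc C₁ * δ * r ^ (n + 1) = δ * C₁ * r ^ (n + 1) := by ring
      _ < (1 / (8 * K)) ^ (n + 1) * ω * r ^ (n + 1) := by gcongr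
      _ = _ := by simp only [ρ]; rw [mul_div_cancel_left₀ _ (by norm_num), div_pow, div_pow]; ring
  -- Moving the centre inward by at most 2ρ costs part of the radius 4ρ but secures |p| < r - ρ, as
  -- the inner estimate requires.
  set p := (1 - 2 * ρ / r) • x
  have h2ρ : 2 * ρ / r ≤ 1 := by rw [div_le_one hr]; linarith
  have hpx : dist p x ≤ 2 * ρ := by
    rw [dist_eq_norm, show p - x = -((2 * ρ / r) • x) by simp only [p]; module, norm_neg,
      norm_smul, Real.norm_eq_abs, abs_of_pos (by positivity), div_mul_eq_mul_div, div_le_iff₀ hr]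
    gcongr
  have hp : ‖p‖ < r - ρ := by
    rw [norm_smul, Real.norm_eq_abs, abs_of_nonneg (by linarith)]
    calc _ ≤ (1 - 2 * ρ / r) * r := by gcongr
      _ = r - 2 * ρ := by field_simp
      _ < _ := by linarith
  have hpE : ball p ρ ⊆ E := (ball_subset_ball' (by linarith)).trans hx
  have hE2 : volume (ball 0 (r - δ * r) \ E) ≤
      ENNReal.ofReal (C₂ * (16 * K) ^ (n + 1) * δ * r ^ (n + 1)) := by
    refine (hint r (δ * r) ρ hr (by positivity) htρ (by linarith) E p hpE hp).trans ?_
    have : 2 * r / ρ = 16 * K := by simp only [ρ]; field_simp; norm_num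
    rw [this]
    exact hI' _ (by positivity)
  have hS1 := hshell r (r + δ * r) hr (by ring) (by linarith)
  have hS2 := hshell (r - δ * r) r (by linarith) (by ring) (by linarith)
  have hsub : E ∆ ball 0 r ⊆ ((E \ ball 0 (r + δ * r)) ∪ (ball 0 (r + δ * r) \ ball 0 r)) ∪
      ((ball 0 (r - δ * r) \ E) ∪ (ball 0 r \ ball 0 (r - δ * r))) := by
    rintro z (⟨hz1, hz2⟩ | ⟨hz1, hz2⟩)
    · left
      by_cases h : z ∈ ball 0 (r + δ * r)
      · exact Or.inr ⟨h, hz2⟩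
      · exact Or.inl ⟨hz1, h⟩
    · right
      by_cases h : z ∈ ball 0 (r - δ * r)
      · exact Or.inl ⟨h, hz2⟩
      · exact Or.inr ⟨hz1, h⟩
  refine (measure_mono hsub).trans ((measure_union_le _ _).trans ?_)
  refine (add_le_add ((measure_union_le _ _).trans (add_le_add hE1 hS1))
    ((measure_union_le _ _).trans (add_le_add hE2 hS2))).trans (le_of_eq ?_)
  rw [← ENNReal.ofReal_add (by positivity) (by positivity),
    ← ENNReal.ofReal_add (by positivity) (by positivity),
    ← ENNReal.ofReal_add (by positivity) (by positivity)]
  congr 1; ring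

/-- For δ ≥ ε, the trivial bound |E| + |B_r| ≤ (K + 1)|B_r| is already of order δr^(n+1). -/
lemma exists_volume_symmDiff_ball_le (n : ℕ) {K : ℝ} (hK : 1 ≤ K) :
    ∃ C : ℝ, 0 < C ∧ ∀ (r δ : ℝ), 0 < r → 0 < δ →
      ∀ E : Set (EuclideanSpace ℝ (Fin (n + 1))),
        volume E ≤ ENNReal.ofReal K * volume (ball (0 : EuclideanSpace ℝ (Fin (n + 1))) r) →
        ENNReal.ofReal (r / K) ≤ inRadius E →
        frontierSqIntegral E r ≤ ENNReal.ofReal (δ ^ 2 * r ^ (n + 2)) →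
        volume (E ∆ ball 0 r) ≤ ENNReal.ofReal (C * δ * r ^ (n + 1)) := by
  obtain ⟨C, hC, ε, hε, h⟩ := exists_volume_symmDiff_ball_le_of_lt n hK
  set ω := volume.real (ball (0 : EuclideanSpace ℝ (Fin (n + 1))) 1)
  have hω : 0 < ω := ENNReal.toReal_pos (measure_ball_pos _ _ one_pos).ne' measure_ball_lt_top.ne
  refine ⟨C + (K + 1) * ω / ε, by positivity, fun r δ hr hδ E hE hin hI => ?_⟩
  rcases lt_or_ge δ ε with hδε | hδε
  · refine (h r δ hr hδ hδε E (ne_top_of_le_ne_top ?_ hE) hin hI).trans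
      (ENNReal.ofReal_le_ofReal ?_)
    · exact ENNReal.mul_ne_top ENNReal.ofReal_ne_top measure_ball_lt_top.ne
    · have : 0 ≤ (K + 1) * ω / ε := by positivity
      gcongr
      linarith
  · have hsub : E ∆ ball 0 r ⊆ E ∪ ball 0 r := symmDiff_subset_union
    refine (measure_mono hsub).trans ((measure_union_le _ _).trans
      ((add_le_add_left hE _).trans ?_))
    rw [volume_ball_eq_ofReal _ hr, ← ENNReal.ofReal_mul (by positivity),
      ← ENNReal.ofReal_add (by positivity) (by positivity)]
    apply ENNReal.ofReal_le_ofReal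
    calc K * (r ^ (n + 1) * ω) + r ^ (n + 1) * ω = (K + 1) * ω / ε * ε * r ^ (n + 1) := by
          field_simp
      _ ≤ (C + (K + 1) * ω / ε) * δ * r ^ (n + 1) := by gcongr; linarith

lemma frontierSqIntegral_eq {n : ℕ} (E : Set (EuclideanSpace ℝ (Fin (n + 1)))) {r : ℝ} (hr : 0 < r) :
    frontierSqIntegral E r = ENNReal.ofReal (r ^ 2) * boundarySqDist E r := by
  rw [boundarySqDist, frontierSqIntegral, ← lintegral_const_mul' _ _ ENNReal.ofReal_ne_top]
  refine lintegral_congr fun x => ?_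
  rw [← ENNReal.ofReal_mul (by positivity), ← mul_pow, mul_sub, mul_div_cancel₀ _ hr.ne', mul_one]

theorem mainTheorem7 (N : ℕ) (hN : 2 ≤ N) (K : ℝ) (hK : 0 < K) :
    ∃ C : ℝ, 0 < C ∧
      ∀ (r : ℝ), 0 < r → ∀ E : Set (EuclideanSpace ℝ (Fin N)),
        HasLipschitzBoundary E →
        volume E ≤ ENNReal.ofReal K * volume (ball (0 : EuclideanSpace ℝ (Fin N)) r) →
        ENNReal.ofReal (r / K) ≤ inRadius E →
        volume (E ∆ ball (0 : EuclideanSpace ℝ (Fin N)) r) /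
            volume (ball (0 : EuclideanSpace ℝ (Fin N)) r) ≤
          ENNReal.ofReal C *
            ((ENNReal.ofReal (r ^ (N - 1)))⁻¹ * boundarySqDist E r) ^ (1 / 2 : ℝ) := by
  obtain ⟨n, rfl⟩ : ∃ n, N = n + 1 := ⟨N - 1, by omega⟩
  obtain ⟨C, hC, h⟩ := exists_volume_symmDiff_ball_le n (le_max_right K 1)
  set ω := volume.real (ball (0 : EuclideanSpace ℝ (Fin (n + 1))) 1)
  have hω : 0 < ω := ENNReal.toReal_pos (measure_ball_pos _ _ one_pos).ne' measure_ball_lt_top.ne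
  refine ⟨C / ω, by positivity, fun r hr E _ hE hin => ?_⟩
  rw [Nat.add_sub_cancel]
  set J := (ENNReal.ofReal (r ^ n))⁻¹ * boundarySqDist E r
  have hrn : ENNReal.ofReal (r ^ n) ≠ 0 := by
    rw [Ne, ENNReal.ofReal_eq_zero, not_le]; positivity
  have hIJ : frontierSqIntegral E r = ENNReal.ofReal (r ^ (n + 2)) * J := by
    rw [frontierSqIntegral_eq E hr, pow_add, mul_comm (r ^ n), ENNReal.ofReal_mul (by positivity),
      mul_assoc, ENNReal.mul_inv_cancel_left hrn ENNReal.ofReal_ne_top]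
  have hE' : volume E ≤
      ENNReal.ofReal (max K 1) * volume (ball (0 : EuclideanSpace ℝ (Fin (n + 1))) r) :=
    hE.trans (by gcongr; exact le_max_left _ _)
  have hin' : ENNReal.ofReal (r / max K 1) ≤ inRadius E :=
    le_trans (ENNReal.ofReal_le_ofReal
      (div_le_div_of_nonneg_left hr.le hK (le_max_left _ _))) hin
  rcases eq_or_ne J ∞ with hJ | hJ
  · rw [hJ, ENNReal.top_rpow_of_pos (by norm_num), ENNReal.mul_top]
    · exact le_top
    · rw [Ne, ENNReal.ofReal_eq_zero, not_le]; positivity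
  have hJr : J ^ (1 / 2 : ℝ) = ENNReal.ofReal √J.toReal := by
    rw [Real.sqrt_eq_rpow, ← ENNReal.ofReal_rpow_of_nonneg ENNReal.toReal_nonneg (by norm_num),
      ENNReal.ofReal_toReal hJ]
  -- J may vanish while the estimate needs δ > 0, so it is applied for every δ > √J and δ then
  -- decreases to √J.
  have hcont : Filter.Tendsto (fun δ : ℝ => ENNReal.ofReal (C / ω) * ENNReal.ofReal δ)
      (nhdsWithin √J.toReal (Ioi √J.toReal))
      (nhds (ENNReal.ofReal (C / ω) * ENNReal.ofReal √J.toReal)) := by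
    refine ENNReal.Tendsto.const_mul (Filter.Tendsto.mono_left ?_ nhdsWithin_le_nhds)
      (Or.inr ENNReal.ofReal_ne_top)
    exact ENNReal.continuous_ofReal.continuousAt
  rw [hJr]
  refine ge_of_tendsto hcont ?_
  filter_upwards [self_mem_nhdsWithin] with δ hδ
  have hδ0 : 0 < δ := (Real.sqrt_nonneg _).trans_lt hδ
  have hJδ : J ≤ ENNReal.ofReal (δ ^ 2) := by
    rw [← ENNReal.ofReal_toReal hJ]
    exact ENNReal.ofReal_le_ofReal ((Real.sqrt_lt' hδ0).1 hδ).le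
  have hvol := h r δ hr hδ0 E hE' hin' (by
    rw [hIJ, mul_comm (δ ^ 2), ENNReal.ofReal_mul (by positivity)]
    gcongr)
  refine ENNReal.div_le_of_le_mul (hvol.trans (le_of_eq ?_))
  rw [volume_ball_eq_ofReal _ hr, ← ENNReal.ofReal_mul (by positivity),
    ← ENNReal.ofReal_mul (by positivity)]
  congr 1
  change C * δ * r ^ (n + 1) = C / ω * δ * (r ^ (n + 1) * ω)
  field_simp
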